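/- Let $d\in\mathbb N$, let $\mathbb F^d$ be the free monoid of all words in the letters $1,\dots,d$ (with unit the empty word $\emptyset$), and let $\mathbb H^2_d=\ell^2(\mathbb F^d)$ be the Fock space, with standard orthonormal basis $(e_\alpha)_{\alpha\in\mathbb F^d}$ and vacuum vector $1=e_\emptyset$. Let $L_1,\dots,L_d$ be the left free shifts, $L_ke_\alpha=e_{k\alpha}$. Let $\mathcal A_d$ be the operator-norm closed unital algebra generated by $L_1,\dots,L_d$ (the free disk algebra), and let $\mathscr A_d=(\mathcal A_d+\mathcal A_d^*)^{-\|\cdot\|}$ be the free disk system; one has $\mathcal A_d^*\mathcal A_d\subseteq\mathscr A_d$. A (positive) NC measure is a positive linear functional $\mu:\mathscr A_d\to\mathbb C$. NC Lebesgue measure $m$ is the vacuum state $m(a)=\langle 1,a1\rangle$. For an NC measure $\mu$, let $\mathbb H^2_d(\mu)$ be the GNS space of $\mu$, that is, the Hilbert space completion of $\mathcal A_d$, modulo the vectors $N_\mu$ of length zero, with respect to the pre-inner product $\langle a_1,a_2\rangle_\mu=\mu(a_1^*a_2)$ (conjugate linear in the first variable). Let $\pi_\mu(a)(b+N_\mu)=ab+N_\mu$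 be the left regular representation of $\mathcal A_d$ on $\mathbb H^2_d(\mu)$, and let $$\Pi_\mu=(\pi_\mu(L_1),\dots,\pi_\mu(L_d)):\mathbb H^2_d(\mu)\otimes\mathbb C^d\to\mathbb H^2_d(\mu)$$ be the GNS row isometry of $\mu$. Proposition. Given any NC measure $\mu$, let $E:\mathbb H^2_d(\mu+m)\to\mathbb H^2_d$ be the contractive embedding, i.e. the continuous linear map determined by $E(a+N_{\mu+m})=a1$ for $a\in\mathcal A_d$, and let $Q_s$ be the orthogonal projection of $\mathbb H^2_d(\mu+m)$ onto $\operatorname{Ker}E$. Then $Q_s$ is reducing for the GNS row isometry $\Pi=\Pi_{\mu+m}$; that is, $M=\operatorname{Ran}Q_s$ satisfies both $\Pi(M\otimes\mathbb C^d)\subseteq M$ and $\Pi^*M\subseteq M\otimes\mathbb C^d$. -/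

import Mathlib

open scoped ComplexOrder InnerProductSpace

noncomputable section

namespace FreeDisk

/-! ### The Fock space and the left free shifts -/

/-- Words in the letters `1, …, d`: the free monoid on `d` letters, with the empty word as unit. -/
abbrev Word (d : ℕ) : Type := List (Fin d)

/-- The Fock space `ℍ²_d`, realised as `ℓ²` of the free monoid on `d` letters. -/
abbrev Fock (d : ℕ) : Type := lp (fun _ : Word d => ℂ) 2

/-- The standard orthonormal basis vector `e_α`. -/
def basisVec {d : ℕ} (α : Word d) : Fock d := lp.single 2 α (1 : ℂ)

/-- The vacuum vector `1 = e_∅`. -/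
def vacuumVec (d : ℕ) : Fock d := basisVec []

/-- The coefficient sequence of `L_k f`: the coefficient of `f` at `α` is moved to `kα`, and the
coefficients at words not beginning with the letter `k` are zero. -/
def shiftFun {d : ℕ} (k : Fin d) (f : Word d → ℂ) : Word d → ℂ
  | [] => 0
  | j :: α => if j = k then f α else 0

theorem shiftFun_cons {d : ℕ} (k : Fin d) (f : Word d → ℂ) (α : Word d) :
    shiftFun k f (k :: α) = f α := by
  simp [shiftFun]

theorem shiftFun_eq_zero {d : ℕ} (k : Fin d) (f : Word d → ℂ) (β : Word d)
    (h : β ∉ Set.range (fun α : Word d => k :: α)) : shiftFun k f β = 0 := by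
  cases β with
  | nil => rfl
  | cons j α =>
    by_cases hj : j = k
    · exact absurd ⟨α, by simp [hj]⟩ h
    · simp [shiftFun, hj]

theorem cons_injective {d : ℕ} (k : Fin d) : Function.Injective (fun α : Word d => k :: α) :=
  fun _ _ h => (List.cons.inj h).2

theorem memlp_shiftFun {d : ℕ} (k : Fin d) (f : Fock d) :
    Memℓp (E := fun _ : Word d => ℂ) (shiftFun k f) 2 := by
  have hf := (lp.memℓp f).summable (by simp)
  refine memℓp_gen ?_
  refine ((cons_injective k).summable_iff ?_).1 ?_
  · intro β hβ
    simp [shiftFun_eq_zero k f β hβ]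
  · simpa [Function.comp_def, shiftFun_cons] using hf

/-- The left free shift `L_k` on the Fock space, `L_k e_α = e_{kα}`. -/
def leftShift {d : ℕ} (k : Fin d) : Fock d →ₗᵢ[ℂ] Fock d where
  toFun f := ⟨shiftFun k f, memlp_shiftFun k f⟩
  map_add' f g := by
    ext β
    cases β with
    | nil => exact (add_zero (0 : ℂ)).symm
    | cons j α =>
      change shiftFun k (f + g) (j :: α) = shiftFun k f (j :: α) + shiftFun k g (j :: α)
      by_cases hj : j = k <;> simp [shiftFun, hj]
  map_smul' c f := by
    ext β
    cases β with
    | nil => simp [shiftFun]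
    | cons j α => by_cases hj : j = k <;> simp [shiftFun, hj]
  norm_map' f := by
    rw [← sq_eq_sq₀ (norm_nonneg _) (norm_nonneg _)]
    have h1 := lp.norm_rpow_eq_tsum (p := 2) (by simp) f
    have h2 := lp.norm_rpow_eq_tsum (p := 2) (by simp)
      (⟨shiftFun k f, memlp_shiftFun k f⟩ : Fock d)
    simp only [ENNReal.toReal_ofNat, Real.rpow_ofNat] at h1 h2
    change ‖(⟨shiftFun k f, memlp_shiftFun k f⟩ : Fock d)‖ ^ 2 = ‖f‖ ^ 2
    rw [h1, h2, ← (cons_injective k).tsum_eq]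
    · simp [shiftFun_cons]
    · intro β hβ
      by_contra h
      exact hβ (by simp [shiftFun_eq_zero k f β h])

theorem leftShift_apply {d : ℕ} (k : Fin d) (f : Fock d) (β : Word d) :
    leftShift k f β = shiftFun k f β := rfl

theorem leftShift_basisVec {d : ℕ} (k : Fin d) (α : Word d) :
    leftShift k (basisVec α) = basisVec (k :: α) := by
  ext β
  rw [leftShift_apply]
  cases β with
  | nil => simp [shiftFun, basisVec]
  | cons j γ =>
    by_cases hj : j = k
    · subst hj
      by_cases hg : γ = α <;> simp [shiftFun, basisVec, hg]
    · simp [shiftFun, basisVec, hj]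

/-- `L_k` as a bounded operator on the Fock space. -/
def shiftOp {d : ℕ} (k : Fin d) : Fock d →L[ℂ] Fock d := (leftShift k).toContinuousLinearMap

/-- `L_j^* L_k = δ_{jk} I`. -/
theorem star_shiftOp_mul_shiftOp {d : ℕ} (j k : Fin d) :
    star (shiftOp j) * shiftOp k = if j = k then 1 else 0 := by
  have key : ∀ f g : Fock d, ⟪shiftOp j f, shiftOp k g⟫_ℂ = if j = k then ⟪f, g⟫_ℂ else 0 := by
    intro f g
    split_ifs with h
    · subst h
      exact (leftShift j).inner_map_map f g
    · rw [lp.inner_eq_tsum]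
      refine (tsum_congr fun β => ?_).trans tsum_zero
      change ⟪shiftFun j f β, shiftFun k g β⟫_ℂ = 0
      cases β with
      | nil => simp [shiftFun]
      | cons i γ =>
        by_cases hi : i = j
        · have : i ≠ k := fun h' => h (hi.symm.trans h')
          simp [shiftFun, this]
        · simp [shiftFun, hi]
  refine ContinuousLinearMap.ext fun g => ext_inner_left ℂ fun f => ?_
  rw [ContinuousLinearMap.star_eq_adjoint]
  change ⟪f, ContinuousLinearMap.adjoint (shiftOp j) (shiftOp k g)⟫_ℂ = _
  rw [ContinuousLinearMap.adjoint_inner_right, key]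
  split_ifs <;> simp

/-! ### The free disk algebra, the free disk system and NC measures -/

/-- The free disk algebra `A_d`: the operator-norm closed unital algebra generated by the left
free shifts. -/
def freeDiskAlgebra (d : ℕ) : Subalgebra ℂ (Fock d →L[ℂ] Fock d) :=
  (Algebra.adjoin ℂ (Set.range (shiftOp (d := d)))).topologicalClosure

/-- The free disk system: the operator-norm closure of `A_d + A_d^*`. -/
def freeDiskSystem (d : ℕ) : Submodule ℂ (Fock d →L[ℂ] Fock d) :=
  (Subalgebra.toSubmodule (freeDiskAlgebra d) ⊔
    (Subalgebra.toSubmodule (freeDiskAlgebra d)).map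
      (starLinearEquiv ℂ (A := Fock d →L[ℂ] Fock d)).toLinearMap).topologicalClosure

/-- A (positive) NC measure: a positive linear functional on the free disk system, which carries
the order of bounded operators. -/
abbrev NCMeasure (d : ℕ) : Type := freeDiskSystem d →ₚ[ℂ] ℂ

/-- Normalized NC Lebesgue measure `m`: the vacuum state `a ↦ ⟨1, a 1⟩`. -/
def lebesgue (d : ℕ) : NCMeasure d :=
  PositiveLinearMap.mk₀
    { toFun := fun a => ⟪vacuumVec d, (a : Fock d →L[ℂ] Fock d) (vacuumVec d)⟫_ℂ
      map_add' := fun a b => by simp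
      map_smul' := fun c a => by simp }
    (fun a ha => by
      have h : (a : Fock d →L[ℂ] Fock d).IsPositive :=
        (ContinuousLinearMap.nonneg_iff_isPositive _).1 ha
      exact h.inner_nonneg_right (vacuumVec d))

theorem shiftOp_mem {d : ℕ} (k : Fin d) : shiftOp k ∈ freeDiskAlgebra d :=
  Subalgebra.le_topologicalClosure _ (Algebra.subset_adjoin ⟨k, rfl⟩)

/-- The left free shift `L_k` as an element of the free disk algebra. -/
def shiftElt {d : ℕ} (k : Fin d) : freeDiskAlgebra d := ⟨shiftOp k, shiftOp_mem k⟩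

theorem mem_system_of_mem {d : ℕ} {a : Fock d →L[ℂ] Fock d} (ha : a ∈ freeDiskAlgebra d) :
    a ∈ freeDiskSystem d :=
  Submodule.le_topologicalClosure _ (Submodule.mem_sup_left ha)

theorem star_mem_system_of_mem {d : ℕ} {a : Fock d →L[ℂ] Fock d} (ha : a ∈ freeDiskAlgebra d) :
    star a ∈ freeDiskSystem d :=
  Submodule.le_topologicalClosure _ (Submodule.mem_sup_right ⟨a, ha, rfl⟩)

theorem monoidClosure_le {d : ℕ} {a : Fock d →L[ℂ] Fock d}
    (ha : a ∈ Submonoid.closure (Set.range (shiftOp (d := d)))) : a ∈ freeDiskAlgebra d :=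
  Subalgebra.le_topologicalClosure _
    ((Submonoid.closure_le (S := (Algebra.adjoin ℂ _).toSubmonoid)).2 Algebra.subset_adjoin ha)

theorem star_mul_mem_of_words {d : ℕ} {a : Fock d →L[ℂ] Fock d}
    (ha : a ∈ Submonoid.closure (Set.range (shiftOp (d := d)))) :
    ∀ b ∈ Submonoid.closure (Set.range (shiftOp (d := d))), star a * b ∈ freeDiskSystem d := by
  induction ha using Submonoid.closure_induction_left with
  | one =>
    intro b hb
    simpa using mem_system_of_mem (monoidClosure_le hb)
  | mul_left x hx y hy ih =>
    obtain ⟨j, rfl⟩ := hx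
    intro b hb
    induction hb using Submonoid.closure_induction_left with
    | one =>
      rw [mul_one]
      exact star_mem_system_of_mem
        (monoidClosure_le (mul_mem (Submonoid.subset_closure ⟨j, rfl⟩) hy))
    | mul_left x' hx' y' hy' _ =>
      obtain ⟨k, rfl⟩ := hx'
      have h : star (shiftOp j * y) * (shiftOp k * y') =
          star y * (star (shiftOp j) * shiftOp k) * y' := by
        rw [star_mul]; simp only [mul_assoc]
      rw [h, star_shiftOp_mul_shiftOp]
      split_ifs
      · simpa using ih y' hy'
      · simp

/-- The semi-Dirichlet property: `A_d^* A_d` is contained in the free disk system. -/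
theorem star_mul_mem {d : ℕ} {a b : Fock d →L[ℂ] Fock d} (ha : a ∈ freeDiskAlgebra d)
    (hb : b ∈ freeDiskAlgebra d) : star a * b ∈ freeDiskSystem d := by
  have hclosed : IsClosed (freeDiskSystem d : Set (Fock d →L[ℂ] Fock d)) :=
    Submodule.isClosed_topologicalClosure _
  have hpoly : ∀ a ∈ Algebra.adjoin ℂ (Set.range (shiftOp (d := d))),
      ∀ b ∈ Algebra.adjoin ℂ (Set.range (shiftOp (d := d))),
        star a * b ∈ freeDiskSystem d := by
    intro a ha b hb
    rw [← Subalgebra.mem_toSubmodule, Algebra.adjoin_eq_span] at ha hb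
    induction ha using Submodule.span_induction with
    | mem x hx =>
      induction hb using Submodule.span_induction with
      | mem y hy => exact star_mul_mem_of_words hx y hy
      | zero => simp
      | add y z _ _ h1 h2 => rw [mul_add]; exact add_mem h1 h2
      | smul c y _ h => rw [mul_smul_comm]; exact Submodule.smul_mem _ c h
    | zero => simp
    | add y z _ _ h1 h2 => rw [star_add, add_mul]; exact add_mem h1 h2
    | smul c y _ h => rw [star_smul, smul_mul_assoc]; exact Submodule.smul_mem _ _ h
  have h := map_mem_closure₂ (f := fun a b : Fock d →L[ℂ] Fock d => star a * b)
    (by fun_prop) (show a ∈ closure _ from ha) (show b ∈ closure _ from hb)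
    (u := (freeDiskSystem d : Set (Fock d →L[ℂ] Fock d))) (fun x hx y hy => hpoly x hx y hy)
  rwa [hclosed.closure_eq] at h

/-- The element `a^* b` of the free disk system, for `a, b` in the free disk algebra. -/
def starMul {d : ℕ} (a b : freeDiskAlgebra d) : freeDiskSystem d :=
  ⟨star (a : Fock d →L[ℂ] Fock d) * b, star_mul_mem a.2 b.2⟩

theorem starMul_self_nonneg {d : ℕ} (a : freeDiskAlgebra d) : 0 ≤ starMul a a :=
  star_mul_self_nonneg (a : Fock d →L[ℂ] Fock d)

theorem starMul_add_right {d : ℕ} (a b c : freeDiskAlgebra d) :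
    starMul a (b + c) = starMul a b + starMul a c := Subtype.ext (by simp [starMul, mul_add])

theorem starMul_add_left {d : ℕ} (a b c : freeDiskAlgebra d) :
    starMul (a + b) c = starMul a c + starMul b c := Subtype.ext (by simp [starMul, add_mul])

theorem starMul_smul_right {d : ℕ} (r : ℂ) (a b : freeDiskAlgebra d) :
    starMul a (r • b) = r • starMul a b := Subtype.ext (by simp [starMul])

theorem starMul_smul_left {d : ℕ} (r : ℂ) (a b : freeDiskAlgebra d) :
    starMul (r • a) b = star r • starMul a b := Subtype.ext (by simp [starMul])

theorem map_starMul_self_nonneg {d : ℕ} (μ : NCMeasure d) (a : freeDiskAlgebra d) :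
    0 ≤ μ (starMul a a) := μ.map_nonneg (starMul_self_nonneg a)

theorem map_starMul_conj {d : ℕ} (μ : NCMeasure d) (a b : freeDiskAlgebra d) :
    star (μ (starMul b a)) = μ (starMul a b) := by
  have im0 : ∀ c : freeDiskAlgebra d, (μ (starMul c c)).im = 0 := fun c =>
    ((Complex.nonneg_iff.1 (map_starMul_self_nonneg μ c)).2).symm
  have h1 := im0 (a + b)
  have h2 := im0 (a + Complex.I • b)
  have ha := im0 a
  have hb := im0 b
  simp only [starMul_add_right, starMul_add_left, starMul_smul_right, starMul_smul_left, map_add,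
    map_smul, smul_eq_mul] at h1 h2
  simp at h1 h2
  apply Complex.ext
  · simp; linarith
  · simp; linarith

/-! ### The GNS space and the GNS row isometry of an NC measure -/

set_option linter.unusedVariables false in
/-- A copy of the free disk algebra carrying the pre-inner product `⟨a, b⟩_μ = μ(a^* b)`. -/
@[nolint unusedArguments]
def PreGNS {d : ℕ} (μ : NCMeasure d) : Type := freeDiskAlgebra d

instance {d : ℕ} (μ : NCMeasure d) : AddCommGroup (PreGNS μ) :=
  inferInstanceAs (AddCommGroup (freeDiskAlgebra d))

instance {d : ℕ} (μ : NCMeasure d) : Module ℂ (PreGNS μ) :=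
  inferInstanceAs (Module ℂ (freeDiskAlgebra d))

/-- An element of the free disk algebra, viewed in the pre-GNS space. -/
def toPreGNS {d : ℕ} (μ : NCMeasure d) : freeDiskAlgebra d ≃ₗ[ℂ] PreGNS μ :=
  LinearEquiv.refl ℂ _

/-- The pre-inner product `⟨a, b⟩_μ = μ(a^* b)`. -/
abbrev preGNSCore {d : ℕ} (μ : NCMeasure d) : PreInnerProductSpace.Core ℂ (PreGNS μ) where
  inner a b := μ (starMul ((toPreGNS μ).symm a) ((toPreGNS μ).symm b))
  conj_inner_symm a b := map_starMul_conj μ _ _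
  re_inner_nonneg a := (Complex.nonneg_iff.1 (map_starMul_self_nonneg μ _)).1
  add_left a b c := by rw [map_add, starMul_add_left, map_add]
  smul_left a b r := by rw [map_smul, starMul_smul_left, map_smul]; rfl

instance {d : ℕ} (μ : NCMeasure d) : SeminormedAddCommGroup (PreGNS μ) :=
  InnerProductSpace.Core.toSeminormedAddCommGroup (c := preGNSCore μ)

instance {d : ℕ} (μ : NCMeasure d) : InnerProductSpace ℂ (PreGNS μ) :=
  InnerProductSpace.ofCore (preGNSCore μ)

theorem preGNS_inner {d : ℕ} (μ : NCMeasure d) (a b : freeDiskAlgebra d) :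
    ⟪toPreGNS μ a, toPreGNS μ b⟫_ℂ = μ (starMul a b) := rfl

theorem preGNS_norm_sq {d : ℕ} (μ : NCMeasure d) (a : freeDiskAlgebra d) :
    ((‖toPreGNS μ a‖ ^ 2 : ℝ) : ℂ) = μ (starMul a a) := by
  rw [← preGNS_inner, inner_self_eq_norm_sq_to_K]
  simp

/-- The GNS space `ℍ²_d(μ)`: the Hausdorff completion of the free disk algebra with respect to
`⟨a, b⟩_μ = μ(a^* b)`, that is, the Hilbert space completion of its quotient by the vectors of
length zero. -/
abbrev GNS {d : ℕ} (μ : NCMeasure d) : Type := UniformSpace.Completion (PreGNS μ)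

/-- The class `a + N_μ` in the GNS space of an element `a` of the free disk algebra. -/
def gnsClass {d : ℕ} (μ : NCMeasure d) (a : freeDiskAlgebra d) : GNS μ :=
  ((toPreGNS μ a : PreGNS μ) : UniformSpace.Completion (PreGNS μ))

theorem starMul_mul_le {d : ℕ} (a b : freeDiskAlgebra d) :
    starMul (a * b) (a * b) ≤ ((‖a‖ ^ 2 : ℝ) : ℂ) • starMul b b := by
  have h := CStarAlgebra.star_left_conjugate_le_norm_smul (a := (b : Fock d →L[ℂ] Fock d))
    (b := star (a : Fock d →L[ℂ] Fock d) * a) (IsSelfAdjoint.star_mul_self _)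
  rw [CStarRing.norm_star_mul_self (x := (a : Fock d →L[ℂ] Fock d)), ← sq,
    ← Complex.coe_smul] at h
  change star ((a : Fock d →L[ℂ] Fock d) * b) * (a * b) ≤ _
  rw [star_mul]
  simp only [mul_assoc] at h ⊢
  exact h

/-- Left multiplication by `a` on the pre-GNS space. -/
def preLeftMul {d : ℕ} (μ : NCMeasure d) (a : freeDiskAlgebra d) : PreGNS μ →L[ℂ] PreGNS μ :=
  ((toPreGNS μ).toLinearMap ∘ₗ LinearMap.mulLeft ℂ a ∘ₗ
    (toPreGNS μ).symm.toLinearMap).mkContinuous ‖a‖ fun x => by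
      obtain ⟨b, rfl⟩ := (toPreGNS μ).surjective x
      rw [← sq_le_sq₀ (norm_nonneg _) (by positivity), mul_pow, ← Complex.real_le_real]
      simp only [LinearMap.comp_apply, LinearEquiv.coe_coe, LinearEquiv.symm_apply_apply,
        LinearMap.mulLeft_apply]
      rw [Complex.ofReal_mul, preGNS_norm_sq, preGNS_norm_sq]
      simpa using OrderHomClass.mono μ (starMul_mul_le a b)

/-- The left regular representation `π_μ` of the free disk algebra on the GNS space,
`π_μ(a) (b + N_μ) = ab + N_μ`. -/
def gnsRep {d : ℕ} (μ : NCMeasure d) (a : freeDiskAlgebra d) : GNS μ →L[ℂ] GNS μ :=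
  (preLeftMul μ a).completion

theorem gnsRep_gnsClass {d : ℕ} (μ : NCMeasure d) (a b : freeDiskAlgebra d) :
    gnsRep μ a (gnsClass μ b) = gnsClass μ (a * b) :=
  ContinuousLinearMap.completion_apply_coe _ _

/-- The component `Π_{μ;k} = π_μ(L_k)` of the GNS row isometry. -/
def gnsShift {d : ℕ} (μ : NCMeasure d) (k : Fin d) : GNS μ →L[ℂ] GNS μ := gnsRep μ (shiftElt k)

theorem inner_gnsShift {d : ℕ} (μ : NCMeasure d) (j k : Fin d) (x y : GNS μ) :
    ⟪gnsShift μ j x, gnsShift μ k y⟫_ℂ = if j = k then ⟪x, y⟫_ℂ else 0 := by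
  induction x, y using UniformSpace.Completion.induction_on₂ with
  | hp => split_ifs <;> apply isClosed_eq <;> fun_prop
  | ih x y =>
    obtain ⟨a, rfl⟩ := (toPreGNS μ).surjective x
    obtain ⟨b, rfl⟩ := (toPreGNS μ).surjective y
    change ⟪gnsRep μ _ (gnsClass μ a), gnsRep μ _ (gnsClass μ b)⟫_ℂ = _
    rw [gnsRep_gnsClass, gnsRep_gnsClass, gnsClass, gnsClass, UniformSpace.Completion.inner_coe,
      UniformSpace.Completion.inner_coe, preGNS_inner, preGNS_inner]
    have h : ((starMul (shiftElt j * a) (shiftElt k * b) : freeDiskSystem d) :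
        Fock d →L[ℂ] Fock d) = star (a : Fock d →L[ℂ] Fock d) *
          (star (shiftOp j) * shiftOp k) * b := by
      simp [starMul, shiftElt, mul_assoc]
    rw [star_shiftOp_mul_shiftOp] at h
    split_ifs at h ⊢ with hjk
    · congr 1
      exact Subtype.ext (by simpa [starMul] using h)
    · rw [show starMul (shiftElt j * a) (shiftElt k * b) = 0 from Subtype.ext (by simpa using h),
        map_zero]

/-- The GNS row isometry `Π_μ = (π_μ(L_1), …, π_μ(L_d)) : ℍ²_d(μ) ⊗ ℂ^d → ℍ²_d(μ)`, where the
`ℓ²` direct sum of `d` copies of the GNS space stands for `ℍ²_d(μ) ⊗ ℂ^d`. -/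
def gnsRow {d : ℕ} (μ : NCMeasure d) : PiLp 2 (fun _ : Fin d => GNS μ) →ₗᵢ[ℂ] GNS μ where
  toFun x := ∑ k, gnsShift μ k (x k)
  map_add' x y := by simp [Finset.sum_add_distrib]
  map_smul' c x := by simp [Finset.smul_sum]
  norm_map' x := by
    change ‖∑ k, gnsShift μ k (x k)‖ = ‖x‖
    have h : ⟪∑ k, gnsShift μ k (x k), ∑ k, gnsShift μ k (x k)⟫_ℂ = ⟪x, x⟫_ℂ := by
      rw [sum_inner, PiLp.inner_apply]
      refine Finset.sum_congr rfl fun j _ => ?_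
      rw [inner_sum]
      simp only [inner_gnsShift, Finset.sum_ite_eq, Finset.mem_univ, if_true]
    rw [inner_self_eq_norm_sq_to_K, inner_self_eq_norm_sq_to_K] at h
    rw [← sq_eq_sq₀ (norm_nonneg _) (norm_nonneg _)]
    exact_mod_cast h

theorem gnsRow_apply {d : ℕ} (μ : NCMeasure d) (x : PiLp 2 (fun _ : Fin d => GNS μ)) :
    gnsRow μ x = ∑ k, gnsShift μ k (x k) := rfl

/-! ### The embedding of the GNS space of `μ + m` into the Fock space -/

theorem norm_apply_vacuumVec_le {d : ℕ} (μ : NCMeasure d) (a : freeDiskAlgebra d) :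
    ‖(a : Fock d →L[ℂ] Fock d) (vacuumVec d)‖ ≤ ‖toPreGNS (μ + lebesgue d) a‖ := by
  rw [← sq_le_sq₀ (norm_nonneg _) (norm_nonneg _), ← Complex.real_le_real, preGNS_norm_sq]
  have h : lebesgue d (starMul a a) =
      ((‖(a : Fock d →L[ℂ] Fock d) (vacuumVec d)‖ ^ 2 : ℝ) : ℂ) := by
    change ⟪vacuumVec d, ContinuousLinearMap.adjoint (a : Fock d →L[ℂ] Fock d)
      ((a : Fock d →L[ℂ] Fock d) (vacuumVec d))⟫_ℂ = _
    rw [ContinuousLinearMap.adjoint_inner_right, inner_self_eq_norm_sq_to_K]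
    simp
  rw [PositiveLinearMap.add_apply, h]
  exact le_add_of_nonneg_left (map_starMul_self_nonneg μ a)

/-- The map `a ↦ a 1` on the free disk algebra, contractive for the norm of `μ + m`. -/
def preEmbedding {d : ℕ} (μ : NCMeasure d) : PreGNS (μ + lebesgue d) →L[ℂ] Fock d :=
  LinearMap.mkContinuous
    { toFun := fun x =>
        (((toPreGNS (μ + lebesgue d)).symm x : freeDiskAlgebra d) : Fock d →L[ℂ] Fock d)
          (vacuumVec d)
      map_add' := fun x y => by simp
      map_smul' := fun c x => by simp } 1 fun x => by
    obtain ⟨a, rfl⟩ := (toPreGNS (μ + lebesgue d)).surjective x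
    simpa using norm_apply_vacuumVec_le μ a

/-- The contractive embedding `E : ℍ²_d(μ + m) → ℍ²_d`: the continuous extension of
`a + N_{μ+m} ↦ a 1`. -/
def embedding {d : ℕ} (μ : NCMeasure d) : GNS (μ + lebesgue d) →L[ℂ] Fock d :=
  (preEmbedding μ).fromCompletion

theorem embedding_gnsClass {d : ℕ} (μ : NCMeasure d) (a : freeDiskAlgebra d) :
    embedding μ (gnsClass (μ + lebesgue d) a) = (a : Fock d →L[ℂ] Fock d) (vacuumVec d) :=
  ContinuousLinearMap.fromCompletion_apply_coe _ _

theorem norm_embedding_le {d : ℕ} (μ : NCMeasure d) : ‖embedding μ‖ ≤ 1 := by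
  refine ContinuousLinearMap.opNorm_le_bound _ zero_le_one fun x => ?_
  induction x using UniformSpace.Completion.induction_on with
  | hp => apply isClosed_le <;> fun_prop
  | ih x =>
    obtain ⟨a, rfl⟩ := (toPreGNS (μ + lebesgue d)).surjective x
    rw [UniformSpace.Completion.norm_coe, one_mul]
    exact (congrArg norm (embedding_gnsClass μ a)).le.trans (norm_apply_vacuumVec_le μ a)

/-! ### Reducing projections -/

/-- The orthogonal projection `P` is reducing for the row operator `V : H ⊗ ℂ^d → H`: its range `M`
is `V`-invariant, `V (M ⊗ ℂ^d) ⊆ M`, and `V`-co-invariant, `V^* M ⊆ M ⊗ ℂ^d`. -/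
def IsReducingProjection {d : ℕ} {H : Type*} [NormedAddCommGroup H] [InnerProductSpace ℂ H]
    [CompleteSpace H] (V : PiLp 2 (fun _ : Fin d => H) →L[ℂ] H) (P : H →L[ℂ] H) : Prop :=
  IsStarProjection P ∧
    (∀ x : PiLp 2 (fun _ : Fin d => H),
      (∀ k, x k ∈ LinearMap.range P.toLinearMap) → V x ∈ LinearMap.range P.toLinearMap) ∧
    (∀ y ∈ LinearMap.range P.toLinearMap, ∀ k,
      (ContinuousLinearMap.adjoint V y) k ∈ LinearMap.range P.toLinearMap)

/-- The orthogonal projection `Q_s` of `ℍ²_d(μ + m)` onto the kernel of the embedding `E`. -/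
def singularProjection {d : ℕ} (μ : NCMeasure d) :
    GNS (μ + lebesgue d) →L[ℂ] GNS (μ + lebesgue d) :=
  (LinearMap.ker (embedding μ).toLinearMap).starProjection

end FreeDisk

end

open scoped ComplexOrder InnerProductSpace

namespace FreeDisk

/-! Write `Π` for the GNS row isometry of `μ + m`. The embedding `E` intertwines it with the free
shifts, `E Π x = ∑ L_k E x_k` (`embedding_gnsRow`), so `Ker E` is invariant at once.

Co-invariance rests on a decomposition. A polynomial in the shifts has the form `c + ∑ L_k f_k` with
`c = ⟨1, a 1⟩`, so its class is `c [1]` plus a vector of `Ran Π`. The scalar equals `⟨1, E x⟩`,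
hence depends continuously on the class `x`; since `Ran Π` is closed, every `x` satisfies `x - ⟨1, E
x⟩ [1] ∈ Ran Π` (`sub_inner_smul_gnsClass_one_mem_range_gnsRow`). If `E y = 0` the scalar vanishes,
so `y = Π z` and `Π^* y = z`. Then `0 = E Π z = ∑ L_k E z_k`, and orthogonality of the ranges of the
`L_k` forces each `E z_k = 0` (`eq_zero_of_sum_shiftOp_eq_zero`). -/

/-! ### Polynomials in the shifts and their GNS classes -/

/-- The canonical map from the free disk algebra to the GNS space is linear and bounded. -/
theorem exists_gnsClass_eq_clm {d : ℕ} (μ : NCMeasure d) :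
    ∃ T : freeDiskAlgebra d →L[ℂ] GNS μ, ∀ a, T a = gnsClass μ a := by
  let T₀ : freeDiskAlgebra d →ₗ[ℂ] GNS μ :=
    (UniformSpace.Completion.toComplL (𝕜 := ℂ) (E := PreGNS μ)).toLinearMap ∘ₗ
      (toPreGNS μ).toLinearMap
  -- The bound comes from `[a] = π_μ(a) [1]` and `‖π_μ(a)‖ ≤ ‖a‖`.
  refine ⟨T₀.mkContinuous ‖toPreGNS μ 1‖ fun a => ?_, fun a => rfl⟩
  change ‖((toPreGNS μ a : PreGNS μ) : UniformSpace.Completion (PreGNS μ))‖ ≤ _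
  rw [UniformSpace.Completion.norm_coe]
  have h1 : preLeftMul μ a (toPreGNS μ 1) = toPreGNS μ a := by
    change toPreGNS μ (a * 1) = _
    rw [mul_one]
  have h2 : ‖preLeftMul μ a‖ ≤ ‖a‖ := LinearMap.mkContinuous_norm_le _ (norm_nonneg _) _
  rw [← h1, mul_comm]
  refine ((preLeftMul μ a).le_opNorm _).trans ?_
  exact mul_le_mul_of_nonneg_right h2 (norm_nonneg _)

/-- Transfers operator-norm density of the polynomials to the GNS norm. -/
theorem continuous_gnsClass {d : ℕ} (μ : NCMeasure d) : Continuous (gnsClass μ) := by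
  obtain ⟨T, hT⟩ := exists_gnsClass_eq_clm μ
  rw [← funext hT]
  exact T.continuous

theorem gnsClass_smul_one_add_sum {d : ℕ} (μ : NCMeasure d) (c : ℂ)
    (f : Fin d → freeDiskAlgebra d) :
    gnsClass μ (c • 1 + ∑ k, shiftElt k * f k) =
      c • gnsClass μ 1 + gnsRow μ (WithLp.toLp 2 fun k => gnsClass μ (f k)) := by
  obtain ⟨T, hT⟩ := exists_gnsClass_eq_clm μ
  have h : ∀ k, gnsShift μ k (gnsClass μ (f k)) = T (shiftElt k * f k) := fun k => by
    rw [hT, gnsShift, gnsRep_gnsClass]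
  rw [gnsRow_apply, Finset.sum_congr rfl fun k _ => h k, ← hT, ← hT, T.map_add, T.map_smul,
    map_sum T]

/-- Polynomials in the left free shifts are dense in the free disk algebra. -/
theorem mem_closure_polynomials {d : ℕ} (a : freeDiskAlgebra d) :
    a ∈ closure {b : freeDiskAlgebra d |
      (b : Fock d →L[ℂ] Fock d) ∈ Algebra.adjoin ℂ (Set.range (shiftOp (d := d)))} := by
  rw [closure_subtype]
  refine closure_mono (fun x hx => ?_)
    (show (a : Fock d →L[ℂ] Fock d) ∈
      closure (Algebra.adjoin ℂ (Set.range (shiftOp (d := d))) : Set _) from a.2)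
  exact ⟨⟨x, Subalgebra.le_topologicalClosure _ hx⟩, hx, rfl⟩

/-- A polynomial in the left free shifts is a constant plus an element of the right ideal
`∑ k, L_k A_d`. -/
theorem exists_eq_smul_one_add_sum_shiftElt_mul {d : ℕ} {a : Fock d →L[ℂ] Fock d}
    (ha : a ∈ Algebra.adjoin ℂ (Set.range (shiftOp (d := d)))) :
    ∃ (c : ℂ) (f : Fin d → freeDiskAlgebra d),
      a = c • 1 + ∑ k, shiftOp k * (f k : Fock d →L[ℂ] Fock d) := by
  induction ha using Algebra.adjoin_induction with
  | mem x hx =>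
    obtain ⟨k, rfl⟩ := hx
    refine ⟨0, Pi.single k 1, ?_⟩
    rw [Finset.sum_eq_single k] <;> simp +contextual
  | algebraMap r => exact ⟨r, 0, by simp [Algebra.algebraMap_eq_smul_one]⟩
  | add x y _ _ hx hy =>
    obtain ⟨c, f, rfl⟩ := hx
    obtain ⟨c', f', rfl⟩ := hy
    refine ⟨c + c', f + f', ?_⟩
    simp only [Pi.add_apply, Subalgebra.coe_add, mul_add, Finset.sum_add_distrib, add_smul]
    abel
  | mul x y _ _ hx hy =>
    obtain ⟨c, f, rfl⟩ := hx
    obtain ⟨c', f', hy'⟩ := hy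
    have hy : y ∈ freeDiskAlgebra d := Subalgebra.le_topologicalClosure _ ‹_›
    -- In `x y = c y + ∑ L_k f_k y` only the `y` multiplied by `c` has to be expanded; the other
    -- terms already lie in the right ideal, so there `y` stays whole.
    refine ⟨c * c', fun k => c • f' k + f k * ⟨y, hy⟩, ?_⟩
    simp only [Subalgebra.coe_add, Subalgebra.coe_smul, Subalgebra.coe_mul, mul_add,
      Finset.sum_add_distrib, add_mul, Finset.sum_mul, mul_smul_comm, smul_mul_assoc, one_mul,
      ← Finset.smul_sum, mul_assoc]
    nth_rewrite 1 [hy']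
    rw [smul_add, smul_smul, add_assoc]

/-! ### The embedding and the vacuum coefficient -/

/-- The embedding intertwines the GNS shifts with the left free shifts. -/
theorem embedding_gnsShift {d : ℕ} (μ : NCMeasure d) (k : Fin d) (x : GNS (μ + lebesgue d)) :
    embedding μ (gnsShift (μ + lebesgue d) k x) = shiftOp k (embedding μ x) := by
  induction x using UniformSpace.Completion.induction_on with
  | hp => apply isClosed_eq <;> fun_prop
  | ih x =>
    obtain ⟨a, rfl⟩ := (toPreGNS (μ + lebesgue d)).surjective x
    change embedding μ (gnsRep _ _ (gnsClass _ a)) = shiftOp k (embedding μ (gnsClass _ a))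
    rw [gnsRep_gnsClass, embedding_gnsClass, embedding_gnsClass]
    rfl

theorem embedding_gnsRow {d : ℕ} (μ : NCMeasure d)
    (x : PiLp 2 (fun _ : Fin d => GNS (μ + lebesgue d))) :
    embedding μ (gnsRow _ x) = ∑ k, shiftOp k (embedding μ (x k)) := by
  simp only [gnsRow_apply, map_sum, embedding_gnsShift]

/-- The vacuum is supported on the empty word, where every shifted vector vanishes. -/
theorem inner_vacuumVec_shiftOp {d : ℕ} (k : Fin d) (f : Fock d) :
    ⟪vacuumVec d, shiftOp k f⟫_ℂ = 0 := by
  rw [lp.inner_eq_tsum]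
  refine (tsum_congr fun β => ?_).trans tsum_zero
  change ⟪vacuumVec d β, shiftFun k f β⟫_ℂ = 0
  cases β with
  | nil => simp [shiftFun]
  | cons j α => simp [vacuumVec, basisVec]

theorem inner_vacuumVec_self (d : ℕ) : ⟪vacuumVec d, vacuumVec d⟫_ℂ = 1 := by
  rw [inner_self_eq_norm_sq_to_K, vacuumVec, basisVec, lp.norm_single (by norm_num)]
  simp

/-- `E` sends the row part into the span of the shift ranges, orthogonal to the vacuum. Thus the
constant term is a function of the vector alone, whatever decomposition is chosen. -/
theorem inner_vacuumVec_embedding {d : ℕ} (μ : NCMeasure d) (c : ℂ)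
    (z : PiLp 2 (fun _ : Fin d => GNS (μ + lebesgue d))) :
    ⟪vacuumVec d, embedding μ (c • gnsClass (μ + lebesgue d) 1 + gnsRow _ z)⟫_ℂ = c := by
  rw [map_add, map_smul, embedding_gnsRow, inner_add_right, inner_sum, inner_smul_right,
    embedding_gnsClass, OneMemClass.coe_one, one_apply_eq_self, inner_vacuumVec_self]
  simp only [inner_vacuumVec_shiftOp, Finset.sum_const_zero, mul_one, add_zero]

/-- The GNS space of `μ + m` is spanned by the class of the unit and the range of the GNS row
isometry; the coefficient of the unit is the vacuum coefficient of the embedding. -/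
theorem sub_inner_smul_gnsClass_one_mem_range_gnsRow {d : ℕ} (μ : NCMeasure d)
    (x : GNS (μ + lebesgue d)) :
    x - ⟪vacuumVec d, embedding μ x⟫_ℂ • gnsClass (μ + lebesgue d) 1 ∈
      Set.range (gnsRow (μ + lebesgue d)) := by
  have hr : IsClosed (Set.range (gnsRow (μ + lebesgue d))) :=
    (gnsRow (μ + lebesgue d)).isometry.isClosedEmbedding.isClosed_range
  have hcont : Continuous fun x : GNS (μ + lebesgue d) =>
      x - ⟪vacuumVec d, embedding μ x⟫_ℂ • gnsClass (μ + lebesgue d) 1 := by fun_prop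
  induction x using UniformSpace.Completion.induction_on with
  | hp => exact hr.preimage hcont
  | ih x =>
    obtain ⟨a, rfl⟩ := (toPreGNS (μ + lebesgue d)).surjective x
    change gnsClass _ a - ⟪vacuumVec d, embedding μ (gnsClass _ a)⟫_ℂ • gnsClass _ 1 ∈ _
    -- The condition is closed, so a second density argument, inside the free disk algebra, reduces
    -- it to polynomials.
    refine closure_minimal (fun b hb => ?_)
      ((hr.preimage hcont).preimage (continuous_gnsClass (μ + lebesgue d)))
      (mem_closure_polynomials a)
    obtain ⟨c, f, hb⟩ := exists_eq_smul_one_add_sum_shiftElt_mul hb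
    have hb' : b = c • 1 + ∑ k, shiftElt k * f k := Subtype.ext (by simpa [shiftElt] using hb)
    refine ⟨WithLp.toLp 2 fun k => gnsClass _ (f k), ?_⟩
    beta_reduce
    rw [hb', gnsClass_smul_one_add_sum, inner_vacuumVec_embedding, add_sub_cancel_left]

/-- The left free shifts have pairwise orthogonal ranges and are injective. -/
theorem eq_zero_of_sum_shiftOp_eq_zero {d : ℕ} {g : Fin d → Fock d}
    (h : ∑ k, shiftOp k (g k) = 0) (j : Fin d) : g j = 0 := by
  -- Since `L_j^* L_k = δ_{jk}`, applying `L_j^*` isolates `g j`.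
  have h' := congrArg (fun f => star (shiftOp (d := d) j) f) h
  simp only [map_sum, map_zero] at h'
  have key : ∀ k, (star (shiftOp j) : Fock d →L[ℂ] Fock d) (shiftOp k (g k)) = if j = k then g k else 0 := fun k => by
    have := congrArg (fun A : Fock d →L[ℂ] Fock d => A (g k)) (star_shiftOp_mul_shiftOp j k)
    simp only [mul_apply_eq_comp] at this
    rw [this]
    split_ifs <;> rfl
  simpa [key] using h'

theorem range_singularProjection {d : ℕ} (μ : NCMeasure d) :
    LinearMap.range (singularProjection μ).toLinearMap =
      LinearMap.ker (embedding μ).toLinearMap :=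
  Submodule.range_starProjection _

end FreeDisk

/-! ### Invariance and co-invariance of the kernel -/

theorem mainTheorem11 (d : ℕ) (μ : FreeDisk.NCMeasure d) :
    FreeDisk.IsReducingProjection
      (FreeDisk.gnsRow (μ + FreeDisk.lebesgue d)).toContinuousLinearMap
      (FreeDisk.singularProjection μ) := by
  refine ⟨isStarProjection_starProjection, ?_, ?_⟩ <;>
    simp only [FreeDisk.range_singularProjection, LinearMap.mem_ker,
      ContinuousLinearMap.coe_coe, LinearIsometry.coe_toContinuousLinearMap]
  · intro x hx
    simp [FreeDisk.embedding_gnsRow, hx]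
  · intro y hy k
    obtain ⟨z, hz⟩ := FreeDisk.sub_inner_smul_gnsClass_one_mem_range_gnsRow μ y
    -- As `E y = 0`, the multiple of `[1]` disappears and `y` itself is in the range of the row
    -- isometry.
    rw [hy, inner_zero_right, zero_smul, sub_zero] at hz
    -- The adjoint of an isometry is a left inverse of it.
    have hadj : ContinuousLinearMap.adjoint
        (FreeDisk.gnsRow (μ + FreeDisk.lebesgue d)).toContinuousLinearMap y = z := by
      refine ext_inner_left ℂ fun w => ?_
      rw [ContinuousLinearMap.adjoint_inner_right, ← hz]
      exact (FreeDisk.gnsRow _).inner_map_map w z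
    rw [hadj]
    rw [← hz, FreeDisk.embedding_gnsRow] at hy
    exact FreeDisk.eq_zero_of_sum_shiftOp_eq_zero hy k
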